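/- For $n\ge 0$ let $\pi=\pi_1\pi_2\cdots\pi_n\in\mathfrak S_n$ be a permutation, and let $R(\pi)$ be the set of its reduced words, i.e. the words $i_1i_2\cdots i_k$ of minimal length with $\pi=s_{i_1}s_{i_2}\cdots s_{i_k}$, where $s_i$ is the adjacent transposition $(i\;\,i+1)$, $1\le i\le n-1$. Let $G_\pi$ be the graph on $R(\pi)$ in which two reduced words are adjacent when one is obtained from the other by a commutation move (exchanging adjacent letters $j,k$ with $|j-k|>1$) or by a long braid move (exchanging consecutive letters $j(j+1)j$ and $(j+1)j(j+1)$). Let $H_{ij}=\{x\in\mathbb R^n: x_i=x_j\}$, $1\le i<j\le n$, be the hyperplanes of the braid arrangement and let $c_0=\{x: x_1<x_2<\cdots<x_n\}$. Let $L_1(\pi)$ be the set of the hyperplanes $H_{ij}$ that separate $c_0$ from $\pi(c_0)$, where $\pi$ acts on $\mathbb R^n$ by $e_i\mapsto e_{\pi_i}$, and let $L_2(\pi)$ be the set of the intersections $X=H\cap K$ of two distinct hyperplanes of the arrangement such that every hyperplane of the arrangement containing $X$ belongs to $L_1(\pi)$. An inversion of $\pi$ is a pair $(i,j)$ with $i<j$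 and $\pi_i>\pi_j$. Let $I_2(\pi)$ be the set of unordered pairs of inversions $(i,j)$, $(k,\ell)$ of $\pi$ with $\{i,j\}\cap\{k,\ell\}=\emptyset$, and let $I_3(\pi)$ be the set of triples $i<j<k$ with $\pi_i>\pi_j>\pi_k$ (the occurrences of the pattern $321$). **Theorem.** If $\pi$ avoids the pattern $312$, i.e. there are no $i<j<k$ with $\pi_j<\pi_k<\pi_i$, then $G_\pi$ is connected and $$\operatorname{diam}(G_\pi)=|L_2(\pi)|=|I_2(\pi)|+|I_3(\pi)| .$$ -/

import Mathlib

namespace RedWord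

/-! ### Patterns, inversions -/

/-- `π` contains the pattern `σ`: some subsequence of the one-line notation of `π`
is order isomorphic to the one-line notation of `σ`. -/
def Contains {n k : ℕ} (π : Equiv.Perm (Fin n)) (σ : Equiv.Perm (Fin k)) : Prop :=
  ∃ f : Fin k ↪o Fin n, ∀ a b : Fin k, σ a ≤ σ b ↔ π (f a) ≤ π (f b)

/-- `π` avoids the pattern `σ`. -/
def Avoids {n k : ℕ} (π : Equiv.Perm (Fin n)) (σ : Equiv.Perm (Fin k)) : Prop :=
  ¬ Contains π σ

/-- The permutation with one-line notation `312` (written `2, 0, 1` on `Fin 3`). -/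
def perm312 : Equiv.Perm (Fin 3) where
  toFun := ![2, 0, 1]
  invFun := ![1, 2, 0]
  left_inv := by decide
  right_inv := by decide

/-- `(i, j)` is an inversion of `π`: `i < j` and `π i > π j`. -/
abbrev IsInversion {n : ℕ} (π : Equiv.Perm (Fin n)) (i j : Fin n) : Prop :=
  i < j ∧ π j < π i

/-- `I₂(π)`: the (unordered) pairs of inversions `(i, j)`, `(k, l)` of `π` whose index sets
`{i, j}` and `{k, l}` are disjoint. Each unordered pair is recorded once, with `i < k`. -/
def I2 {n : ℕ} (π : Equiv.Perm (Fin n)) : Finset ((Fin n × Fin n) × (Fin n × Fin n)) :=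
  {p | IsInversion π p.1.1 p.1.2 ∧ IsInversion π p.2.1 p.2.2 ∧
    Disjoint ({p.1.1, p.1.2} : Finset (Fin n)) {p.2.1, p.2.2} ∧ p.1.1 < p.2.1}

/-- `I₃(π)`: the triples `(i, j, k)` such that `(i, j)`, `(i, k)`, `(j, k)` are all inversions
of `π`, that is, the occurrences of the pattern `321`. -/
def I3 {n : ℕ} (π : Equiv.Perm (Fin n)) : Finset (Fin n × Fin n × Fin n) :=
  {t | IsInversion π t.1 t.2.1 ∧ IsInversion π t.1 t.2.2 ∧ IsInversion π t.2.1 t.2.2}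

/-! ### Reduced words and their graph -/

/-- The simple reflection exchanging the two consecutive elements `i`, `i + 1` of `Fin n`. -/
def simpleRefl {n : ℕ} (i : Fin (n - 1)) : Equiv.Perm (Fin n) :=
  Equiv.swap ⟨i.1, by omega⟩ ⟨i.1 + 1, by omega⟩

/-- The product `s_{i₁} s_{i₂} ⋯ s_{iₖ}` for a word `i₁ i₂ ⋯ iₖ`. -/
def wordProd {n : ℕ} (w : List (Fin (n - 1))) : Equiv.Perm (Fin n) :=
  (w.map simpleRefl).prod

/-- `w` is a reduced word for `π`: its product is `π` and it has minimal length. -/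
def IsReducedWord {n : ℕ} (π : Equiv.Perm (Fin n)) (w : List (Fin (n - 1))) : Prop :=
  wordProd w = π ∧ ∀ w' : List (Fin (n - 1)), wordProd w' = π → w.length ≤ w'.length

/-- `R(π)`, the reduced words for `π`. -/
abbrev R {n : ℕ} (π : Equiv.Perm (Fin n)) : Type :=
  {w : List (Fin (n - 1)) // IsReducedWord π w}

/-- Commutation move: exchange adjacent letters `j`, `k` with `|j - k| > 1`. -/
inductive CommMove {m : ℕ} : List (Fin m) → List (Fin m) → Prop
  | mk (u v : List (Fin m)) (j k : Fin m) (h : j.1 + 1 < k.1 ∨ k.1 + 1 < j.1) :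
      CommMove (u ++ [j, k] ++ v) (u ++ [k, j] ++ v)

/-- Long braid move: exchange consecutive letters `j k j` for `k j k`, where `|j - k| = 1`. -/
inductive BraidMove {m : ℕ} : List (Fin m) → List (Fin m) → Prop
  | mk (u v : List (Fin m)) (j k : Fin m) (h : j.1 + 1 = k.1 ∨ k.1 + 1 = j.1) :
      BraidMove (u ++ [j, k, j] ++ v) (u ++ [k, j, k] ++ v)

theorem CommMove.symm {m : ℕ} {w w' : List (Fin m)} (h : CommMove w w') : CommMove w' w := by
  cases h with
  | mk u v j k h => exact CommMove.mk u v k j h.symm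

theorem BraidMove.symm {m : ℕ} {w w' : List (Fin m)} (h : BraidMove w w') : BraidMove w' w := by
  cases h with
  | mk u v j k h => exact BraidMove.mk u v k j h.symm

theorem CommMove.ne {m : ℕ} {w w' : List (Fin m)} (h : CommMove w w') : w ≠ w' := by
  cases h with
  | mk u v j k h =>
    intro e
    simp at e
    rcases e with ⟨rfl, -⟩
    omega

theorem BraidMove.ne {m : ℕ} {w w' : List (Fin m)} (h : BraidMove w w') : w ≠ w' := by
  cases h with
  | mk u v j k h =>
    intro e
    simp at e
    rcases e with ⟨rfl, -⟩
    omega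

/-- The graph `G_π` on `R(π)`, with an edge for each commutation move and each long braid move. -/
def G {n : ℕ} (π : Equiv.Perm (Fin n)) : SimpleGraph (R π) where
  Adj w w' := CommMove w.1 w'.1 ∨ BraidMove w.1 w'.1
  symm := ⟨fun _ _ h => h.imp CommMove.symm BraidMove.symm⟩
  loopless := ⟨fun _ h => h.elim (fun h => h.ne rfl) (fun h => h.ne rfl)⟩

/-! ### The braid arrangement -/

/-- The hyperplane `H_{ij} = {x | x i = x j}` of `ℝⁿ`. -/
def hyper {n : ℕ} (i j : Fin n) : Submodule ℝ (Fin n → ℝ) where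
  carrier := {x | x i = x j}
  add_mem' := by
    intro x y hx hy
    simp only [Set.mem_ofPred_eq, Pi.add_apply] at *
    rw [hx, hy]
  zero_mem' := rfl
  smul_mem' := by
    intro c x hx
    simp only [Set.mem_ofPred_eq, Pi.smul_apply] at *
    rw [hx]

/-- The reflection arrangement of type `A_{n-1}`: all `H_{ij}` with `i < j`. -/
def arrangement (n : ℕ) : Set (Submodule ℝ (Fin n → ℝ)) :=
  {H | ∃ i j : Fin n, i < j ∧ H = hyper i j}

/-- The base chamber `c₀ = {x | x₁ < x₂ < ⋯ < xₙ}`. -/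
def baseChamber (n : ℕ) : Set (Fin n → ℝ) :=
  {x | StrictMono x}

/-- The chamber `π(c₀)`, where `π` permutes coordinates by `e_i ↦ e_{π i}`. -/
def permChamber {n : ℕ} (π : Equiv.Perm (Fin n)) : Set (Fin n → ℝ) :=
  (fun x i => x (π.symm i)) '' baseChamber n

/-- The hyperplane `H` separates `c` from `c'`: they lie strictly on opposite sides of `H`. -/
def Separates {n : ℕ} (H : Submodule ℝ (Fin n → ℝ)) (c c' : Set (Fin n → ℝ)) : Prop :=
  ∃ f : (Fin n → ℝ) →ₗ[ℝ] ℝ, LinearMap.ker f = H ∧ (∀ x ∈ c, 0 < f x) ∧ ∀ y ∈ c', f y < 0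

/-- `L₁(π)`: the hyperplanes of the arrangement separating `c₀` from `π(c₀)`. -/
def L1 {n : ℕ} (π : Equiv.Perm (Fin n)) : Set (Submodule ℝ (Fin n → ℝ)) :=
  {H | H ∈ arrangement n ∧ Separates H (baseChamber n) (permChamber π)}

/-- `L₂(π)`: the codimension-two intersections `X = H ∩ K` of two distinct hyperplanes of the
arrangement such that every hyperplane of the arrangement containing `X` belongs to `L₁(π)`. -/
def L2 {n : ℕ} (π : Equiv.Perm (Fin n)) : Set (Submodule ℝ (Fin n → ℝ)) :=
  {X | (∃ H ∈ arrangement n, ∃ K ∈ arrangement n, H ≠ K ∧ X = H ⊓ K) ∧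
    ∀ H ∈ arrangement n, X ≤ H → H ∈ L1 π}

end RedWord

/-!
Draw a word as a gallery of strands, the letter `i` exchanging the strands in the positions `i` and
`i + 1`. A word is reduced exactly if the strand of the smallest value never turns back and, once
it is erased, the same holds for the word of the other strands. All crossings of this strand can be
postponed to the end of the word; the potential of a word is the number of moves spent when the
strands are postponed one after another, from the smallest value on. A move passes at most one
crossing over one strand, so it changes the potential by at most one, and the word of potential `0`
is at distance at most the potential.

If `π` avoids `312`, the values before the smallest one are smaller than those after it. Hence no
crossing exchanges a strand that ends before the smallest value with one that ends after it, and
the strand of the smallest value can also be advanced to the beginning of the word. In every word, a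
crossing of two other strands then costs the same total for postponing and advancing: the number of
inversions of the smallest value that are disjoint from it, plus one if it forms a `321`-pattern
with the smallest value. Summing over the strands, the total is `D = |I₂(π)| + |I₃(π)|`, so every
word of potential `f` is at distance at most `D - f` from one fixed word, whose potential is `D`.
This word and the one of potential `0` realize the diameter `D`: any two words are joined by a path
of length at most `D` through one of them.

The flats in `L₂(π)` are `x_{π i} = x_{π j}, x_{π k} = x_{π l}` for pairs `(i, j)`, `(k, l)` of
disjoint inversions and `x_{π i} = x_{π j} = x_{π k}` for `321`-patterns, so there are `D` of them.
-/

namespace RedWord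

/-! ### Distances in graphs -/

section Graph

variable {V W : Type*} {G : SimpleGraph V} {H : SimpleGraph W}

theorem edist_le_of_simulation (r : V → W → Prop) (hr : Relator.RightUnique r)
    (hadj : ∀ ⦃a b x⦄, r a x → G.Adj a b → ∃ y, r b y ∧ H.Adj x y)
    {u v : V} {x y : W} (hu : r u x) (hv : r v y) : H.edist x y ≤ G.edist u v := by
  refine le_iInf fun p => ?_
  induction p generalizing x with
  | nil => simp [hr hu hv]
  | cons h p ih =>
    obtain ⟨z, hz, hxz⟩ := hadj hu h
    calc H.edist x y ≤ H.edist x z + H.edist z y := SimpleGraph.edist_triangle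
      _ ≤ 1 + p.length := by
        rw [SimpleGraph.edist_eq_one_iff_adj.2 hxz]
        gcongr
        exact ih hz hv
      _ = (SimpleGraph.Walk.cons h p).length := by
        rw [SimpleGraph.Walk.length_cons, Nat.cast_add, Nat.cast_one, add_comm]

theorem edist_map_le (f : G →g H) (u v : V) : H.edist (f u) (f v) ≤ G.edist u v :=
  edist_le_of_simulation (fun a x => f a = x) (fun _ _ _ h h' => h.symm.trans h')
    (fun _ b _ h hab => ⟨f b, rfl, h ▸ f.map_adj hab⟩) rfl rfl

theorem edist_le_add {u v w : V} {d e : ℕ} (h : G.edist u v ≤ d) (h' : G.edist v w ≤ e) :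
    G.edist u w ≤ (d + e : ℕ) :=
  SimpleGraph.edist_triangle.trans ((add_le_add h h').trans_eq (Nat.cast_add d e).symm)

theorem le_add_edist {f : V → ℕ} (hf : ∀ ⦃u v⦄, G.Adj u v → f u ≤ f v + 1) (u v : V) :
    (f u : ℕ∞) ≤ f v + G.edist u v := by
  rw [SimpleGraph.edist, ENat.add_iInf]
  refine le_iInf fun p => ?_
  norm_cast
  induction p with
  | nil => exact le_rfl
  | cons h p ih =>
    rw [SimpleGraph.Walk.length_cons]
    have := hf h
    omega

/-- From `u` to `v` it takes at most `f u + f v` steps through `a` and at most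
`(D - f u) + (D - f v)` steps through `b`; one of the two is at most `D`. -/
theorem ediam_eq_of_potential {f : V → ℕ} {D : ℕ} {a b : V}
    (hf : ∀ ⦃u v⦄, G.Adj u v → f u ≤ f v + 1) (ha : f a = 0) (hb : f b = D)
    (hua : ∀ u, G.edist u a ≤ f u) (hub : ∀ u, G.edist u b + f u ≤ D) : G.ediam = D := by
  have hvb (v : V) : G.edist v b ≤ (D - f v : ℕ) := by
    rw [ENat.natCast_sub]
    exact ENat.le_sub_of_add_le_right (ENat.natCast_ne_top _) (hub v)
  have hfD (v : V) : f v ≤ D := by exact_mod_cast le_add_self.trans (hub v)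
  refine le_antisymm (SimpleGraph.ediam_le_of_edist_le fun u v => ?_) ?_
  · have huv_a := edist_le_add (hua u) (SimpleGraph.edist_comm.trans_le (hua v))
    have huv_b := edist_le_add (hvb u) (SimpleGraph.edist_comm.trans_le (hvb v))
    have := hfD u
    have := hfD v
    rcases le_total (f u + f v) D with h | h
    · exact huv_a.trans (by exact_mod_cast h)
    · exact huv_b.trans (by norm_cast; omega)
  · have := le_add_edist hf b a
    rw [ha, hb, Nat.cast_zero, zero_add] at this
    exact this.trans SimpleGraph.edist_le_ediam

end Graph

/-! ### Moves between words -/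

/-- A commutation move or a long braid move between words in the natural numbers. Letters that are
not bounded by `n - 1` let a strand be deleted or inserted without a change of type. -/
inductive Move : List ℕ → List ℕ → Prop
  | comm {j k : ℕ} (h : j + 1 < k ∨ k + 1 < j) (v : List ℕ) : Move (j :: k :: v) (k :: j :: v)
  | braid {j k : ℕ} (h : j + 1 = k ∨ k + 1 = j) (v : List ℕ) :
      Move (j :: k :: j :: v) (k :: j :: k :: v)
  | cons (i : ℕ) {w w' : List ℕ} (h : Move w w') : Move (i :: w) (i :: w')

namespace Move

variable {w w' : List ℕ}

theorem symm (h : Move w w') : Move w' w := by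
  induction h with
  | comm h v => exact comm h.symm v
  | braid h v => exact braid h.symm v
  | cons i _ ih => exact cons i ih

theorem ne (h : Move w w') : w ≠ w' := by
  induction h with
  | comm h v => simp; omega
  | braid h v => simp; omega
  | cons i _ ih => simpa using ih

theorem append_left (u : List ℕ) (h : Move w w') : Move (u ++ w) (u ++ w') := by
  induction u with
  | nil => exact h
  | cons i u ih => exact cons i ih

theorem append_right (v : List ℕ) (h : Move w w') : Move (w ++ v) (w' ++ v) := by
  induction h with
  | comm h u => exact comm h (u ++ v)
  | braid h u => exact braid h (u ++ v)
  | cons i _ ih => exact cons i ih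

theorem mem_iff (h : Move w w') (i : ℕ) : i ∈ w ↔ i ∈ w' := by
  induction h with
  | comm _ v => simp only [List.mem_cons]; tauto
  | braid _ v => simp only [List.mem_cons]; tauto
  | cons i _ ih => simp only [List.mem_cons, ih]

end Move

/-- All words in the natural numbers, joined by moves. The graphs `G π` are unions of components
of this graph. -/
def moveGraph : SimpleGraph (List ℕ) where
  Adj := Move
  symm := ⟨fun _ _ => Move.symm⟩
  loopless := ⟨fun _ h => h.ne rfl⟩

theorem edist_append_left (u w w' : List ℕ) :
    moveGraph.edist (u ++ w) (u ++ w') ≤ moveGraph.edist w w' :=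
  edist_map_le (G := moveGraph) (H := moveGraph) ⟨(u ++ ·), fun h => Move.append_left u h⟩ w w'

theorem edist_append_right (v w w' : List ℕ) :
    moveGraph.edist (w ++ v) (w' ++ v) ≤ moveGraph.edist w w' :=
  edist_map_le (G := moveGraph) (H := moveGraph) ⟨(· ++ v), fun h => Move.append_right v h⟩ w w'

theorem edist_cons (i : ℕ) (w w' : List ℕ) :
    moveGraph.edist (i :: w) (i :: w') ≤ moveGraph.edist w w' :=
  edist_append_left [i] w w'

theorem Move.edist_le {w w' : List ℕ} (h : Move w w') : moveGraph.edist w w' ≤ (1 : ℕ) :=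
  (SimpleGraph.edist_eq_one_iff_adj.2 h).le

theorem edist_commute_past {i : ℕ} {l : List ℕ} (h : ∀ x ∈ l, i + 1 < x ∨ x + 1 < i) :
    moveGraph.edist (i :: l) (l ++ [i]) ≤ l.length := by
  induction l with
  | nil => simp
  | cons x l ih =>
    rw [List.length_cons, add_comm l.length]
    exact edist_le_add (Move.comm (h x (by simp)) l).edist_le
      ((edist_cons x _ _).trans (ih fun y hy => h y (by simp [hy])))

theorem edist_commute_range {i p m : ℕ} (h : i + 1 < p ∨ p + m < i) :
    moveGraph.edist (i :: List.range' p m) (List.range' p m ++ [i]) ≤ m := by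
  simpa using edist_commute_past (i := i) (l := List.range' p m) fun x hx => by
    rw [List.mem_range'_1] at hx
    omega

theorem edist_braid_range {i p m : ℕ} (h : p ≤ i) (h' : i + 1 < p + m) :
    moveGraph.edist ((i + 1) :: List.range' p m) (List.range' p m ++ [i]) ≤ (m - 1 : ℕ) := by
  obtain ⟨a, rfl⟩ := Nat.exists_eq_add_of_le h
  obtain ⟨b, rfl⟩ : ∃ b, m = a + (2 + b) := ⟨m - a - 2, by omega⟩
  have hsplit : List.range' p (a + (2 + b)) =
      List.range' p a ++ (p + a) :: (p + a + 1) :: List.range' (p + a + 2) b := by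
    rw [← List.range'_append_1, ← List.range'_append_1 (s := p + a)]
    simp [List.range'_succ]
  have before : moveGraph.edist
      ((p + a + 1) :: (List.range' p a ++ (p + a) :: (p + a + 1) :: List.range' (p + a + 2) b))
      (List.range' p a ++ (p + a + 1) :: (p + a) :: (p + a + 1) :: List.range' (p + a + 2) b)
      ≤ a := by
    simpa using (edist_append_right _ _ _).trans (edist_commute_range (i := p + a + 1) (by omega))
  have braid := (Move.append_left (List.range' p a) (Move.braid (j := p + a + 1) (k := p + a)
    (.inr rfl) (List.range' (p + a + 2) b))).edist_le
  have after : moveGraph.edist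
      (List.range' p a ++ (p + a) :: (p + a + 1) :: (p + a) :: List.range' (p + a + 2) b)
      (List.range' p a ++ (p + a) :: (p + a + 1) :: (List.range' (p + a + 2) b ++ [p + a]))
      ≤ b := by
    simpa using (edist_append_left (List.range' p a ++ [p + a, p + a + 1]) _ _).trans
      (edist_commute_range (i := p + a) (p := p + a + 2) (m := b) (by omega))
  have := edist_le_add (edist_le_add before braid) after
  rw [hsplit, show a + (2 + b) - 1 = a + 1 + b by omega]
  simpa using this

/-! ### The gallery of a word and its strands -/

/-- The final position of the strand that starts in position `p`, where the letter `i` exchanges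
the strands in the positions `i` and `i + 1`. -/
def strandEnd : ℕ → List ℕ → ℕ
  | p, [] => p
  | p, i :: w =>
    if i = p then strandEnd (p + 1) w else if i + 1 = p then strandEnd i w else strandEnd p w

/-- The word of the remaining strands when the one that starts in position `p` is erased. -/
def eraseStrand : ℕ → List ℕ → List ℕ
  | _, [] => []
  | p, i :: w =>
    if i = p then eraseStrand (p + 1) w
    else if i + 1 = p then eraseStrand i w
    else (if i < p then i else i - 1) :: eraseStrand p w

/-- The strand that starts in position `p` never moves to the left. -/
inductive IsRightward : ℕ → List ℕ → Prop
  | nil (p : ℕ) : IsRightward p []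
  | cross {p : ℕ} {w : List ℕ} (h : IsRightward (p + 1) w) : IsRightward p (p :: w)
  | left {p i : ℕ} {w : List ℕ} (hi : i + 1 < p) (h : IsRightward p w) : IsRightward p (i :: w)
  | right {p i : ℕ} {w : List ℕ} (hi : p ≤ i) (h : IsRightward p w) :
      IsRightward p ((i + 1) :: w)

/-- The number of moves that let all other crossings take place before those of the strand that
starts in position `p`, once this strand has been prolonged to start in position `0`. -/
def postponeCost : ℕ → List ℕ → ℕ
  | _, [] => 0
  | p, i :: w =>
    if i = p then postponeCost (p + 1) w else (if i < p then p - 1 else p) + postponeCost p w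

/-- The number of moves that let all other crossings take place after those of the strand from
position `p` to position `k`. -/
def advanceCost (k : ℕ) : ℕ → List ℕ → ℕ
  | _, [] => 0
  | p, i :: w =>
    if i = p then advanceCost k (p + 1) w
    else (if i < p ∨ k < i then k - p else k - p - 1) + advanceCost k p w

/-- The renaming of the letter `j` when a strand is inserted that stays in position `k`. It makes
sense for `j + 1 ≠ k` only: otherwise the inserted strand separates the positions `j`, `j + 1`. -/
def lift (k j : ℕ) : ℕ := if j + 1 < k then j else j + 1

@[simp] theorem lift_zero (j : ℕ) : lift 0 j = j + 1 := rfl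

/-- The sum of `postponeCost` and `advanceCost` for a strand that passes from position `0` to
position `k`, expressed in the word `w` of the other strands. -/
def crossCount (k : ℕ) (w : List ℕ) : ℕ := (w.map fun j => if j + 1 < k then k - 1 else k).sum

section Recursion
variable {p i k : ℕ} {w : List ℕ}

@[simp] theorem strandEnd_nil : strandEnd p [] = p := rfl
@[simp] theorem strandEnd_cross : strandEnd p (p :: w) = strandEnd (p + 1) w := by
  simp [strandEnd]
theorem strandEnd_left (h : i + 1 < p) : strandEnd p (i :: w) = strandEnd p w := by
  grind [strandEnd]
theorem strandEnd_right (h : p ≤ i) : strandEnd p ((i + 1) :: w) = strandEnd p w := by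
  grind [strandEnd]

@[simp] theorem eraseStrand_nil : eraseStrand p [] = [] := rfl
@[simp] theorem eraseStrand_cross : eraseStrand p (p :: w) = eraseStrand (p + 1) w := by
  simp [eraseStrand]
theorem eraseStrand_left (h : i + 1 < p) : eraseStrand p (i :: w) = i :: eraseStrand p w := by
  grind [eraseStrand]
theorem eraseStrand_right (h : p ≤ i) :
    eraseStrand p ((i + 1) :: w) = i :: eraseStrand p w := by
  grind [eraseStrand]

@[simp] theorem postponeCost_cross : postponeCost p (p :: w) = postponeCost (p + 1) w := by
  simp [postponeCost]
theorem postponeCost_left (h : i + 1 < p) :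
    postponeCost p (i :: w) = p - 1 + postponeCost p w := by
  grind [postponeCost]
theorem postponeCost_right (h : p ≤ i) :
    postponeCost p ((i + 1) :: w) = p + postponeCost p w := by
  grind [postponeCost]

@[simp] theorem advanceCost_cross : advanceCost k p (p :: w) = advanceCost k (p + 1) w := by
  simp [advanceCost]
theorem advanceCost_left (h : i + 1 < p) :
    advanceCost k p (i :: w) = k - p + advanceCost k p w := by
  grind [advanceCost]
theorem advanceCost_right (h : p ≤ i) :
    advanceCost k p ((i + 1) :: w) =
      (if k ≤ i then k - p else k - p - 1) + advanceCost k p w := by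
  grind [advanceCost]

theorem crossCount_cons :
    crossCount k (i :: w) = (if i + 1 < k then k - 1 else k) + crossCount k w := by
  simp [crossCount]

theorem isRightward_cons :
    IsRightward p (i :: w) ↔
      i = p ∧ IsRightward (p + 1) w ∨ i ≠ p ∧ i + 1 ≠ p ∧ IsRightward p w := by
  constructor
  · rintro (_ | h | ⟨hi, h⟩ | ⟨hi, h⟩) <;> grind
  · rintro (⟨rfl, h⟩ | ⟨h1, h2, h⟩)
    · exact .cross h
    · rcases lt_or_ge i p with hi | hi
      · exact .left (by omega) h
      · obtain ⟨j, rfl⟩ : ∃ j, i = j + 1 := ⟨i - 1, by omega⟩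
        exact .right (by omega) h

@[simp] theorem isRightward_cross : IsRightward p (p :: w) ↔ IsRightward (p + 1) w := by
  simp [isRightward_cons]
theorem isRightward_left (h : i + 1 < p) : IsRightward p (i :: w) ↔ IsRightward p w := by
  grind [isRightward_cons]
theorem isRightward_right (h : p ≤ i) : IsRightward p ((i + 1) :: w) ↔ IsRightward p w := by
  grind [isRightward_cons]

end Recursion

theorem IsRightward.le_strandEnd {p : ℕ} {w : List ℕ} (h : IsRightward p w) :
    p ≤ strandEnd p w := by
  induction h <;> grind [strandEnd]

theorem length_eraseStrand_add_strandEnd_le (p : ℕ) (w : List ℕ) :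
    (eraseStrand p w).length + strandEnd p w ≤ w.length + p := by
  induction w generalizing p <;> grind [strandEnd, eraseStrand]

theorem isRightward_iff_length {p : ℕ} {w : List ℕ} :
    IsRightward p w ↔ w.length + p ≤ (eraseStrand p w).length + strandEnd p w := by
  constructor
  · intro h
    induction h <;> grind [strandEnd, eraseStrand]
  · induction w generalizing p with
    | nil => exact fun _ => .nil p
    | cons i w ih =>
      have hle := length_eraseStrand_add_strandEnd_le
      intro h
      rcases lt_trichotomy i p with hi | rfl | hi
      · rcases (show i + 1 ≤ p from hi).eq_or_lt with rfl | hi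
        · grind [strandEnd, eraseStrand]
        · exact .left hi (ih (by grind [strandEnd, eraseStrand]))
      · exact .cross (ih (by grind [strandEnd, eraseStrand]))
      · obtain ⟨j, rfl⟩ := Nat.exists_eq_add_of_lt hi
        exact .right (by omega) (ih (by grind [strandEnd, eraseStrand]))

theorem edist_postpone {p : ℕ} {w : List ℕ} (h : IsRightward p w) :
    moveGraph.edist (List.range' 0 p ++ w)
      ((eraseStrand p w).map (lift 0) ++ List.range' 0 (strandEnd p w)) ≤ postponeCost p w := by
  induction h with
  | nil p => simp
  | @cross p w _ ih =>
    rw [strandEnd_cross, eraseStrand_cross, postponeCost_cross]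
    simpa [← List.range'_append_1 (m := p) (n := 1)] using ih
  | @left p i w hi _ ih =>
    rw [strandEnd_left hi, eraseStrand_left hi, postponeCost_left hi]
    have swap := (edist_append_right w _ _).trans
      (edist_braid_range (i := i) (p := 0) (m := p) (by omega) (by omega))
    rw [SimpleGraph.edist_comm] at swap
    simpa using edist_le_add swap ((edist_cons (i + 1) _ _).trans ih)
  | @right p i w hi _ ih =>
    rw [strandEnd_right hi, eraseStrand_right hi, postponeCost_right hi]
    have swap := (edist_append_right w _ _).trans
      (edist_commute_range (i := i + 1) (p := 0) (m := p) (by omega))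
    rw [SimpleGraph.edist_comm] at swap
    simpa using edist_le_add swap ((edist_cons (i + 1) _ _).trans ih)

theorem edist_advance {p : ℕ} {w : List ℕ} (h : IsRightward p w)
    (hk : ∀ j ∈ eraseStrand p w, j + 1 ≠ strandEnd p w) :
    moveGraph.edist w (List.range' p (strandEnd p w - p) ++
      (eraseStrand p w).map (lift (strandEnd p w))) ≤ advanceCost (strandEnd p w) p w := by
  induction h with
  | nil p => simp
  | @cross p w h ih =>
    have := h.le_strandEnd
    rw [strandEnd_cross, eraseStrand_cross] at *
    rw [advanceCost_cross, ← Nat.sub_add_cancel (Nat.sub_pos_of_lt this), Nat.sub_sub,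
      List.range'_succ]
    exact (edist_cons p _ _).trans (ih hk)
  | @left p i w hi h ih =>
    have hp := h.le_strandEnd
    rw [strandEnd_left hi, eraseStrand_left hi] at *
    rw [List.forall_mem_cons] at hk
    generalize strandEnd p w = k at *
    have hlift : lift k i = i := if_pos (by omega)
    rw [advanceCost_left hi, add_comm (k - p), List.map_cons, hlift]
    simpa using edist_le_add ((edist_cons i _ _).trans (ih hk.2)) ((edist_append_right _ _ _).trans
      (edist_commute_range (i := i) (p := p) (m := k - p) (by omega)))
  | @right p i w hi h ih =>
    have hp := h.le_strandEnd
    rw [strandEnd_right hi, eraseStrand_right hi] at *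
    rw [List.forall_mem_cons] at hk
    generalize strandEnd p w = k at *
    rw [advanceCost_right hi, add_comm (ite _ _ _), List.map_cons]
    rcases lt_or_gt_of_ne hk.1 with hik | hik
    · have hlift : lift k i = i := if_pos hik
      rw [if_neg (by omega), hlift]
      simpa using edist_le_add ((edist_cons _ _ _).trans (ih hk.2))
        ((edist_append_right _ _ _).trans
          (edist_braid_range (i := i) (p := p) (m := k - p) (by omega) (by omega)))
    · have hlift : lift k i = i + 1 := if_neg (by omega)
      rw [if_pos (by omega), hlift]
      simpa using edist_le_add ((edist_cons _ _ _).trans (ih hk.2))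
        ((edist_append_right _ _ _).trans
          (edist_commute_range (i := i + 1) (p := p) (m := k - p) (by omega)))

theorem postponeCost_add_advanceCost {p : ℕ} {w : List ℕ} (h : IsRightward p w)
    (hk : ∀ j ∈ eraseStrand p w, j + 1 ≠ strandEnd p w) :
    postponeCost p w + advanceCost (strandEnd p w) p w =
      crossCount (strandEnd p w) (eraseStrand p w) := by
  induction h with
  | nil p => rfl
  | cross _ ih => simpa using ih (by simpa using hk)
  | @left p i w hi h ih =>
    have hp := h.le_strandEnd
    simp only [strandEnd_left hi, eraseStrand_left hi, postponeCost_left hi, advanceCost_left hi,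
      crossCount_cons, List.forall_mem_cons] at hk ⊢
    grind
  | @right p i w hi h ih =>
    have hp := h.le_strandEnd
    simp only [strandEnd_right hi, eraseStrand_right hi, postponeCost_right hi,
      advanceCost_right hi, crossCount_cons, List.forall_mem_cons] at hk ⊢
    grind

/-- A move either exchanges crossings of the other strands, or moves such a crossing past the
strand. -/
theorem IsRightward.move {p : ℕ} {w w' : List ℕ} (hw : IsRightward p w) (h : Move w w') :
    IsRightward p w' ∧ strandEnd p w' = strandEnd p w ∧
      (Move (eraseStrand p w) (eraseStrand p w') ∧ postponeCost p w = postponeCost p w' ∨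
        eraseStrand p w = eraseStrand p w' ∧ postponeCost p w ≤ postponeCost p w' + 1) := by
  induction h generalizing p with
  | comm h v =>
    grind [isRightward_cons, strandEnd, eraseStrand, postponeCost, Move.comm]
  | @braid j k h v =>
    obtain hp | hp | hp : min j k = p ∨ max j k + 1 < p ∨ p < min j k := by
      grind [isRightward_cons]
    · rcases h with rfl | rfl <;> grind [isRightward_cons, strandEnd, eraseStrand, postponeCost]
    · have hj : j + 1 < p := by omega
      have hk : k + 1 < p := by omega
      simp only [isRightward_left hj, isRightward_left hk, strandEnd_left hj, strandEnd_left hk,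
        eraseStrand_left hj, eraseStrand_left hk, postponeCost_left hj, postponeCost_left hk] at *
      exact ⟨hw, trivial, .inl ⟨.braid h _, trivial⟩⟩
    · obtain ⟨j, rfl⟩ : ∃ i, j = i + 1 := ⟨j - 1, by omega⟩
      obtain ⟨k, rfl⟩ : ∃ i, k = i + 1 := ⟨k - 1, by omega⟩
      have hj : p ≤ j := by omega
      have hk : p ≤ k := by omega
      simp only [isRightward_right hj, isRightward_right hk, strandEnd_right hj, strandEnd_right hk,
        eraseStrand_right hj, eraseStrand_right hk, postponeCost_right hj, postponeCost_right hk]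
        at *
      exact ⟨hw, trivial, .inl ⟨.braid (by omega) _, trivial⟩⟩
  | cons i _ ih =>
    grind [isRightward_cons, strandEnd, eraseStrand, postponeCost, Move.cons]

section LiftedWords

variable {p k m : ℕ} {u v w w' : List ℕ}

theorem Move.map_lift (h : Move w w') (hw : ∀ j ∈ w, j + 1 ≠ k) :
    Move (w.map (lift k)) (w'.map (lift k)) := by
  induction h with
  | comm h v =>
    simp only [List.forall_mem_cons] at hw
    exact .comm (by grind [lift]) _
  | braid h v =>
    simp only [List.forall_mem_cons] at hw
    exact .braid (by grind [lift]) _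
  | cons i _ ih => exact .cons _ (ih fun j hj => hw j (by simp [hj]))

theorem edist_map_lift (hw : ∀ j ∈ w, j + 1 ≠ k) (hw' : ∀ j ∈ w', j + 1 ≠ k) :
    moveGraph.edist (w.map (lift k)) (w'.map (lift k)) ≤ moveGraph.edist w w' :=
  edist_le_of_simulation (fun u x => (∀ j ∈ u, j + 1 ≠ k) ∧ u.map (lift k) = x)
    (by rintro _ _ _ ⟨-, rfl⟩ ⟨-, rfl⟩; rfl)
    (fun _ b _ ⟨ha, hx⟩ h => ⟨b.map (lift k),
      ⟨fun j hj => ha j ((Move.mem_iff h j).2 hj), rfl⟩, hx ▸ Move.map_lift h ha⟩)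
    ⟨hw, rfl⟩ ⟨hw', rfl⟩

theorem strandEnd_range_append :
    strandEnd p (List.range' p m ++ v) = strandEnd (p + m) v := by
  induction m generalizing p <;> grind [List.range'_succ, strandEnd]

theorem eraseStrand_range_append :
    eraseStrand p (List.range' p m ++ v) = eraseStrand (p + m) v := by
  induction m generalizing p <;> grind [List.range'_succ, eraseStrand]

theorem isRightward_range_append :
    IsRightward p (List.range' p m ++ v) ↔ IsRightward (p + m) v := by
  induction m generalizing p <;> grind [List.range'_succ, isRightward_cross]

theorem postponeCost_range_append :
    postponeCost p (List.range' p m ++ v) = postponeCost (p + m) v := by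
  induction m generalizing p <;> grind [List.range'_succ, postponeCost]

theorem strandEnd_map_lift_append (hu : ∀ j ∈ u, j + 1 ≠ p) :
    strandEnd p (u.map (lift p) ++ v) = strandEnd p v := by
  induction u with
  | nil => rfl
  | cons j u ih => rw [List.forall_mem_cons] at hu; grind [strandEnd, lift]

theorem eraseStrand_map_lift_append (hu : ∀ j ∈ u, j + 1 ≠ p) :
    eraseStrand p (u.map (lift p) ++ v) = u ++ eraseStrand p v := by
  induction u with
  | nil => rfl
  | cons j u ih => rw [List.forall_mem_cons] at hu; grind [eraseStrand, lift]

theorem isRightward_map_lift_append (hu : ∀ j ∈ u, j + 1 ≠ p) :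
    IsRightward p (u.map (lift p) ++ v) ↔ IsRightward p v := by
  induction u with
  | nil => rfl
  | cons j u ih => rw [List.forall_mem_cons] at hu; grind [isRightward_cons, lift]

theorem postponeCost_map_lift_append (hu : ∀ j ∈ u, j + 1 ≠ p) :
    postponeCost p (u.map (lift p) ++ v) = crossCount p u + postponeCost p v := by
  induction u with
  | nil => simp [crossCount]
  | cons j u ih => rw [List.forall_mem_cons] at hu; grind [postponeCost, lift, crossCount_cons]

theorem crossCount_zero (u : List ℕ) : crossCount 0 u = 0 := by
  simp [crossCount]

theorem crossCount_eq (k : ℕ) (u : List ℕ) : crossCount k u =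
    (k - 1) * u.countP (· + 1 < k) + k * (u.length - u.countP (· + 1 < k)) := by
  induction u with
  | nil => rfl
  | cons j u ih =>
    have := u.countP_le_length (p := (· + 1 < k))
    rw [crossCount_cons, ih]
    by_cases h : j + 1 < k
    · simp only [h, if_true, List.countP_cons_of_pos, decide_true, List.length_cons,
        Nat.add_sub_add_right]
      ring
    · simp only [h, if_false, List.countP_cons_of_neg, decide_false, Bool.false_eq_true,
        not_false_eq_true, List.length_cons, Nat.succ_sub this,
        Nat.succ_eq_add_one]
      ring

end LiftedWords

theorem IsRightward.ne_of_mem {p k : ℕ} {w : List ℕ} (h : IsRightward p w) (hk : strandEnd p w ≤ k)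
    (hw : ∀ j ∈ eraseStrand p w, j + 1 ≠ k) : ∀ i ∈ w, i ≠ k := by
  induction h with
  | nil => simp
  | cross h ih => have := h.le_strandEnd; grind [strandEnd, eraseStrand]
  | left hi h ih =>
    have := h.le_strandEnd
    simp only [strandEnd_left hi, eraseStrand_left hi, List.forall_mem_cons] at hk hw ⊢
    exact ⟨by omega, ih hk hw.2⟩
  | right hi h ih =>
    have := h.le_strandEnd
    simp only [strandEnd_right hi, eraseStrand_right hi, List.forall_mem_cons] at hk hw ⊢
    exact ⟨hw.1, ih hk hw.2⟩

theorem IsRightward.countP_lt {p k : ℕ} {w : List ℕ} (h : IsRightward p w)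
    (hk : strandEnd p w ≤ k) :
    w.countP (· < k) + p = strandEnd p w + (eraseStrand p w).countP (· + 1 < k) := by
  induction h with
  | nil => simp
  | cross h ih => have := h.le_strandEnd; grind [strandEnd, eraseStrand]
  | left hi h ih => have := h.le_strandEnd; grind [strandEnd, eraseStrand]
  | right hi h ih => have := h.le_strandEnd; grind [strandEnd, eraseStrand]

/-! ### Words as permutations -/

/-- The one-line notation that arises from `f` when a new smallest value is inserted in position
`p`. -/
def insertMin (p : ℕ) (f : ℕ → ℕ) (x : ℕ) : ℕ :=
  if x = p then 0 else if x < p then f x + 1 else f (x - 1) + 1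

/-- The product `s_{i₁} s_{i₂} ⋯ s_{iₖ}`, as a permutation of the natural numbers. -/
def natProd (w : List ℕ) : Equiv.Perm ℕ := (w.map fun i => Equiv.swap i (i + 1)).prod

/-- The extension of a permutation of `Fin n` to the natural numbers by the identity. -/
noncomputable def extendNat {n : ℕ} : Equiv.Perm (Fin n) →* Equiv.Perm ℕ :=
  Equiv.Perm.viaEmbeddingHom Fin.valEmbedding

theorem insertMin_injective {p q : ℕ} {f g : ℕ → ℕ} (h : insertMin p f = insertMin q g) :
    p = q ∧ f = g := by
  have hpq : p = q := by
    have := congrFun h p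
    grind [insertMin]
  subst hpq
  refine ⟨rfl, funext fun x => ?_⟩
  have := congrFun h x
  have := congrFun h (x + 1)
  grind [insertMin]

theorem insertMin_zero_id : insertMin 0 id = id := by
  ext x
  grind [insertMin]

theorem insertMin_comp_swap_right (p : ℕ) (f : ℕ → ℕ) :
    insertMin p f ∘ Equiv.swap p (p + 1) = insertMin (p + 1) f := by
  ext x
  grind [insertMin]

theorem insertMin_comp_swap_left (p : ℕ) (f : ℕ → ℕ) :
    insertMin (p + 1) f ∘ Equiv.swap p (p + 1) = insertMin p f := by
  ext x
  grind [insertMin]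

theorem insertMin_comp_swap {i p : ℕ} (h : i ≠ p) (h' : i + 1 ≠ p) (f : ℕ → ℕ) :
    insertMin p f ∘ Equiv.swap i (i + 1) =
      insertMin p (f ∘ Equiv.swap (if i < p then i else i - 1)
        ((if i < p then i else i - 1) + 1)) := by
  ext x
  grind [insertMin]

theorem coe_natProd_cons (i : ℕ) (w : List ℕ) :
    ⇑(natProd (i :: w)) = Equiv.swap i (i + 1) ∘ natProd w := by
  simp [natProd]

theorem insertMin_comp_natProd (p : ℕ) (f : ℕ → ℕ) (w : List ℕ) :
    insertMin p f ∘ natProd w = insertMin (strandEnd p w) (f ∘ natProd (eraseStrand p w)) := by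
  induction w generalizing p f with
  | nil => rfl
  | cons i w ih =>
    rw [coe_natProd_cons, ← Function.comp_assoc, strandEnd, eraseStrand]
    split_ifs with h h'
    · rw [h, insertMin_comp_swap_right, ih]
    · rw [← h', insertMin_comp_swap_left, ih]
    all_goals rw [insertMin_comp_swap h h', ih, coe_natProd_cons, Function.comp_assoc]; simp [*]

theorem natProd_eq_insertMin (w : List ℕ) :
    ⇑(natProd w) = insertMin (strandEnd 0 w) (natProd (eraseStrand 0 w)) := by
  simpa [insertMin_zero_id] using insertMin_comp_natProd 0 id w

theorem extendNat_injective {n : ℕ} : Function.Injective (extendNat (n := n)) :=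
  Equiv.Perm.viaEmbeddingHom_injective _

theorem extendNat_apply {n : ℕ} (π : Equiv.Perm (Fin n)) (x : Fin n) : extendNat π x = π x :=
  Equiv.Perm.viaEmbedding_apply π Fin.valEmbedding x

theorem extendNat_of_le {n x : ℕ} (π : Equiv.Perm (Fin n)) (h : n ≤ x) : extendNat π x = x :=
  Equiv.Perm.viaEmbedding_apply_of_notMem π Fin.valEmbedding x <| by simpa using h

theorem extendNat_simpleRefl {n : ℕ} (i : Fin (n - 1)) :
    extendNat (simpleRefl i : Equiv.Perm (Fin n)) = Equiv.swap i.1 (i.1 + 1) := by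
  ext x
  rcases lt_or_ge x n with hx | hx
  · rw [← Fin.val_mk hx, extendNat_apply]
    grind [simpleRefl]
  · rw [extendNat_of_le _ hx]
    grind

theorem extendNat_wordProd {n : ℕ} (w : List (Fin (n - 1))) :
    extendNat (wordProd w : Equiv.Perm (Fin n)) = natProd (w.map Fin.val) := by
  simp only [wordProd, natProd, map_list_prod, List.map_map, Function.comp_def,
    extendNat_simpleRefl]

/-! ### Deleting the smallest value of a permutation -/

/-- The position of the smallest value in the one-line notation of `π`. -/
def minPos {n : ℕ} (π : Equiv.Perm (Fin (n + 1))) : Fin (n + 1) := π.symm 0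

@[simp] theorem apply_minPos {n : ℕ} (π : Equiv.Perm (Fin (n + 1))) : π (minPos π) = 0 :=
  π.apply_symm_apply 0

theorem apply_succAbove_minPos_ne_zero {n : ℕ} (π : Equiv.Perm (Fin (n + 1))) (j : Fin n) :
    π ((minPos π).succAbove j) ≠ 0 := fun h =>
  Fin.succAbove_ne _ _ (π.injective (h.trans (apply_minPos π).symm))

/-- The permutation that remains when the smallest value is deleted from the one-line notation of
`π` and the other values are decreased by one. -/
noncomputable def deleteMin {n : ℕ} (π : Equiv.Perm (Fin (n + 1))) : Equiv.Perm (Fin n) :=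
  Equiv.ofBijective
    (fun j => (π ((minPos π).succAbove j)).pred (apply_succAbove_minPos_ne_zero π j))
    (Finite.injective_iff_bijective.1 fun _ _ h =>
      Fin.succAbove_right_injective (π.injective (Fin.pred_inj.1 h)))

@[simp] theorem apply_succAbove_minPos {n : ℕ} (π : Equiv.Perm (Fin (n + 1))) (j : Fin n) :
    π ((minPos π).succAbove j) = (deleteMin π j).succ :=
  (Fin.succ_pred _ (apply_succAbove_minPos_ne_zero π j)).symm

theorem extendNat_eq_insertMin {n : ℕ} (π : Equiv.Perm (Fin (n + 1))) :
    ⇑(extendNat π) = insertMin (minPos π) (extendNat (deleteMin π)) := by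
  ext x
  rcases lt_or_ge x (n + 1) with hx | hx
  · rw [← Fin.val_mk hx, extendNat_apply]
    rcases Fin.eq_self_or_eq_succAbove (minPos π) ⟨x, hx⟩ with h | ⟨j, h⟩
    · obtain rfl : x = minPos π := congrArg Fin.val h
      simp [insertMin]
    · rw [h, apply_succAbove_minPos, Fin.val_succ, ← extendNat_apply]
      grind [insertMin, Fin.succAbove]
  · rw [extendNat_of_le _ hx]
    grind [insertMin, extendNat_of_le]

/-- The word `w` is reduced for `π`, in terms of its gallery: the strand of the smallest value ends
in the right position without ever turning back, and so do the strands of the larger values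
after the erasure of the smaller ones. -/
def IsStrandReduced : {n : ℕ} → Equiv.Perm (Fin n) → List ℕ → Prop
  | 0, _, w => w = []
  | _ + 1, π, w => IsRightward 0 w ∧ strandEnd 0 w = minPos π ∧
      IsStrandReduced (deleteMin π) (eraseStrand 0 w)

/-- The number of moves that straighten all strands of a word for a permutation of `n` elements
in turn, beginning with the strand of the smallest value. -/
def potential : ℕ → List ℕ → ℕ
  | 0, _ => 0
  | n + 1, w => postponeCost 0 w + potential n (eraseStrand 0 w)

/-- The reduced word for `π` in which the smallest value crosses the other ones last. -/
noncomputable def lastWord : {n : ℕ} → Equiv.Perm (Fin n) → List ℕ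
  | 0, _ => []
  | _ + 1, π => (lastWord (deleteMin π)).map (lift 0) ++ List.range' 0 (minPos π)

/-- The reduced word for `π`, when `π` avoids `312`, in which the smallest value crosses the
other ones first. -/
noncomputable def firstWord : {n : ℕ} → Equiv.Perm (Fin n) → List ℕ
  | 0, _ => []
  | _ + 1, π => List.range' 0 (minPos π) ++ (firstWord (deleteMin π)).map (lift (minPos π))

/-- The number of inversions of `π` among the first `k` positions. -/
def invCount {n : ℕ} (k : ℕ) (π : Equiv.Perm (Fin n)) : ℕ :=
  Finset.card {p : Fin n × Fin n | IsInversion π p.1 p.2 ∧ p.2.1 < k}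

/-- Every value in the first `k` positions of `π` is smaller than every later value. -/
def Separated {n : ℕ} (k : ℕ) (π : Equiv.Perm (Fin n)) : Prop :=
  ∀ x y : Fin n, x.1 < k → k ≤ y.1 → π x < π y

section Delete

variable {n : ℕ} {π : Equiv.Perm (Fin (n + 1))} {k : ℕ}

theorem not_isInversion_minPos (π : Equiv.Perm (Fin (n + 1))) (j : Fin (n + 1)) :
    ¬ IsInversion π (minPos π) j := by
  simp [IsInversion]

theorem isInversion_succAbove_minPos (π : Equiv.Perm (Fin (n + 1))) (i : Fin n) :
    IsInversion π ((minPos π).succAbove i) (minPos π) ↔ i.1 < (minPos π).1 := by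
  simp only [IsInversion, apply_minPos, apply_succAbove_minPos, Fin.succ_pos, and_true,
    Fin.succAbove_lt_iff_castSucc_lt]
  rfl

theorem isInversion_succAbove (π : Equiv.Perm (Fin (n + 1))) (i j : Fin n) :
    IsInversion π ((minPos π).succAbove i) ((minPos π).succAbove j) ↔
      IsInversion (deleteMin π) i j := by
  simp [IsInversion]

theorem invCount_eq_sum {n : ℕ} (k : ℕ) (π : Equiv.Perm (Fin n)) :
    invCount k π = ∑ a : Fin n, ∑ b : Fin n, if IsInversion π a b ∧ b.1 < k then 1 else 0 := by
  rw [invCount, Finset.card_filter, Fintype.sum_prod_type]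

theorem sum_val_lt (hk : k ≤ n) : (∑ i : Fin n, if i.1 < k then 1 else 0) = k := by
  rw [← Finset.card_filter, Fin.card_filter_val_lt, min_eq_right hk]

theorem succAbove_lt_succ_iff {m : Fin (n + 1)} (hk : m ≤ k) (j : Fin n) :
    (m.succAbove j).1 < k + 1 ↔ j.1 < k := by
  grind [Fin.succAbove]

theorem invCount_succ (hk : minPos π ≤ k) :
    invCount (k + 1) π = minPos π + invCount k (deleteMin π) := by
  simp only [invCount_eq_sum, Fin.sum_univ_succAbove _ (minPos π), not_isInversion_minPos,
    isInversion_succAbove_minPos, isInversion_succAbove, succAbove_lt_succ_iff hk, false_and,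
    if_false, Finset.sum_const_zero, zero_add, add_zero, Nat.lt_succ_of_le hk, and_true,
    Finset.sum_add_distrib, sum_val_lt (minPos π).is_le]

theorem separated_deleteMin (h : Separated (k + 1) π) :
    minPos π ≤ k ∧ Separated k (deleteMin π) := by
  have hk : minPos π ≤ k := by
    by_contra! hk
    simpa using h 0 (minPos π) (by simp) hk
  refine ⟨hk, fun x y hx hy => ?_⟩
  simpa using h ((minPos π).succAbove x) ((minPos π).succAbove y)
    ((succAbove_lt_succ_iff hk x).2 hx) (not_lt.1 ((succAbove_lt_succ_iff hk y).not.2 hy.not_gt))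

theorem avoids_deleteMin {τ : Equiv.Perm (Fin k)} (h : Avoids π τ) :
    Avoids (deleteMin π) τ := by
  rintro ⟨f, hf⟩
  exact h ⟨f.trans (minPos π).succAboveOrderEmb, fun a b => by simp [hf]⟩

/-- A larger value before `minPos π` and a smaller one after it would form the pattern `312` with
the value in `minPos π`. -/
theorem Avoids.separated (h : Avoids π perm312) : Separated (minPos π) (deleteMin π) := by
  intro x y hx hy
  by_contra! hxy
  have hlt : deleteMin π y < deleteMin π x :=
    hxy.lt_of_ne ((deleteMin π).injective.ne (by rintro rfl; omega))
  have hx' : (minPos π).succAbove x < minPos π := (Fin.succAbove_lt_iff_castSucc_lt _ _).2 hx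
  have hy' : minPos π < (minPos π).succAbove y := (Fin.lt_succAbove_iff_le_castSucc _ _).2 hy
  refine h ⟨OrderEmbedding.ofStrictMono
    ![(minPos π).succAbove x, minPos π, (minPos π).succAbove y] ?_, fun a b => ?_⟩
  · rw [Fin.strictMono_iff_lt_succ]
    intro i
    fin_cases i
    · exact hx'
    · exact hy'
  · fin_cases a <;> fin_cases b <;> simp [perm312, hlt, hlt.le]

end Delete

/-! ### Reduced words as galleries with monotone strands -/

section Gallery

variable {n k : ℕ} {π : Equiv.Perm (Fin n)} {w w' : List ℕ}

theorem invCount_self_succ (π : Equiv.Perm (Fin (n + 1))) :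
    invCount (n + 1) π = minPos π + invCount n (deleteMin π) :=
  invCount_succ (minPos π).is_le

theorem IsStrandReduced.natProd_eq (h : IsStrandReduced π w) : natProd w = extendNat π := by
  induction n generalizing w with
  | zero =>
    obtain rfl : w = [] := h
    rw [Subsingleton.elim π 1, map_one]
    rfl
  | succ n ih =>
    refine DFunLike.coe_injective ?_
    rw [natProd_eq_insertMin, extendNat_eq_insertMin, h.2.1, ih h.2.2]

theorem IsStrandReduced.length_eq (h : IsStrandReduced π w) : w.length = invCount n π := by
  induction n generalizing w with
  | zero => simp [show w = [] from h, invCount_eq_sum]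
  | succ n ih =>
    have := isRightward_iff_length.1 h.1
    have := length_eraseStrand_add_strandEnd_le 0 w
    have := h.2.1
    have := ih h.2.2
    rw [invCount_self_succ]
    omega

theorem invCount_le_length (h : natProd w = extendNat π) : invCount n π ≤ w.length := by
  induction n generalizing w with
  | zero => simp [invCount_eq_sum]
  | succ n ih =>
    have h := congrArg (⇑) h
    rw [natProd_eq_insertMin, extendNat_eq_insertMin] at h
    obtain ⟨hp, he⟩ := insertMin_injective h
    have := ih (DFunLike.coe_injective he)
    have := length_eraseStrand_add_strandEnd_le 0 w
    rw [invCount_self_succ]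
    omega

theorem isStrandReduced_of_length_le (h : natProd w = extendNat π)
    (hw : w.length ≤ invCount n π) : IsStrandReduced π w := by
  induction n generalizing w with
  | zero => exact List.eq_nil_of_length_eq_zero (by simpa [invCount_eq_sum] using hw)
  | succ n ih =>
    have h := congrArg (⇑) h
    rw [natProd_eq_insertMin, extendNat_eq_insertMin] at h
    obtain ⟨hp, he⟩ := insertMin_injective h
    have he := DFunLike.coe_injective he
    have := invCount_le_length he
    have := length_eraseStrand_add_strandEnd_le 0 w
    rw [invCount_self_succ] at hw
    exact ⟨isRightward_iff_length.2 (by omega), hp, ih he (by omega)⟩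

theorem IsStrandReduced.forall_ne_and_countP_eq (h : IsStrandReduced π w) (hk : Separated k π) :
    (∀ i ∈ w, i + 1 ≠ k) ∧ w.countP (· + 1 < k) = invCount k π := by
  induction n generalizing w k with
  | zero => simp [show w = [] from h, invCount_eq_sum]
  | succ n ih =>
    cases k with
    | zero => simp [invCount]
    | succ k =>
      obtain ⟨hmk, hk⟩ := separated_deleteMin hk
      obtain ⟨hne, hcount⟩ := ih h.2.2 hk
      rw [← h.2.1] at hmk
      rw [invCount_succ (h.2.1 ▸ hmk), ← hcount, ← h.2.1, ← h.1.countP_lt hmk]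
      simpa using h.1.ne_of_mem hmk hne

theorem IsStrandReduced.add_one_lt (h : IsStrandReduced π w) : ∀ i ∈ w, i + 1 < n := by
  intro i hi
  by_contra! hn
  exact (h.forall_ne_and_countP_eq (k := i + 1) fun x y _ hy => by omega).1 i hi rfl

theorem IsStrandReduced.move (h : IsStrandReduced π w) (hm : Move w w') :
    IsStrandReduced π w' ∧ potential n w ≤ potential n w' + 1 := by
  induction n generalizing w w' with
  | zero =>
    obtain rfl : w = [] := h
    cases hm
  | succ n ih =>
    obtain ⟨hright, hend, herase⟩ := h.1.move hm
    rcases herase with ⟨hmove, hcost⟩ | ⟨heq, hcost⟩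
    · obtain ⟨hred, hpot⟩ := ih h.2.2 hmove
      exact ⟨⟨hright, hend.trans h.2.1, hred⟩, by simp only [potential]; omega⟩
    · exact ⟨⟨hright, hend.trans h.2.1, heq ▸ h.2.2⟩, by simp only [potential, heq]; omega⟩

theorem isStrandReduced_lastWord (π : Equiv.Perm (Fin n)) :
    IsStrandReduced π (lastWord π) ∧ potential n (lastWord π) = 0 := by
  induction n with
  | zero => exact ⟨rfl, rfl⟩
  | succ n ih =>
    have hu : ∀ j ∈ lastWord (deleteMin π), j + 1 ≠ 0 := fun j _ => j.succ_ne_zero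
    have hw : lastWord π =
        (lastWord (deleteMin π)).map (lift 0) ++ (List.range' 0 (minPos π) ++ []) := by
      rw [List.append_nil, lastWord]
    simp only [hw, IsStrandReduced, potential, isRightward_map_lift_append hu,
      strandEnd_map_lift_append hu, eraseStrand_map_lift_append hu,
      postponeCost_map_lift_append hu, isRightward_range_append, strandEnd_range_append,
      eraseStrand_range_append, postponeCost_range_append]
    simpa [IsRightward.nil, crossCount_zero, postponeCost] using ih (deleteMin π)

theorem IsStrandReduced.edist_lastWord_le (h : IsStrandReduced π w) :
    moveGraph.edist w (lastWord π) ≤ potential n w := by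
  induction n generalizing w with
  | zero => simp [show w = [] from h, lastWord]
  | succ n ih =>
    have hlast := (edist_append_right (List.range' 0 (minPos π)) _ _).trans
      ((edist_map_lift (k := 0) (by simp) (by simp)).trans (ih h.2.2))
    have hpost := edist_postpone h.1
    rw [h.2.1] at hpost
    exact edist_le_add hpost hlast

end Gallery

/-! ### Counting pairs and triples of inversions -/

section Counting

variable {n k : ℕ}

theorem card_I2_eq_sum (π : Equiv.Perm (Fin n)) :
    (I2 π).card = ∑ i, ∑ j, ∑ a, ∑ b, if IsInversion π i j ∧ IsInversion π a b ∧
      (i ≠ a ∧ i ≠ b ∧ j ≠ a ∧ j ≠ b) ∧ i < a then 1 else 0 := by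
  simp only [I2, Finset.card_filter, Fintype.sum_prod_type, Finset.disjoint_insert_left,
    Finset.disjoint_singleton_left, Finset.mem_insert, Finset.mem_singleton, not_or, ne_eq,
    and_assoc]

theorem card_I3_eq_sum (π : Equiv.Perm (Fin n)) :
    (I3 π).card = ∑ i, ∑ j, ∑ k,
      if IsInversion π i j ∧ IsInversion π i k ∧ IsInversion π j k then 1 else 0 := by
  simp only [I3, Finset.card_filter, Fintype.sum_prod_type]

theorem card_I3_eq_add (π : Equiv.Perm (Fin (n + 1))) :
    (I3 π).card = invCount (minPos π) (deleteMin π) + (I3 (deleteMin π)).card := by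
  simp only [card_I3_eq_sum, invCount_eq_sum, Fin.sum_univ_succAbove _ (minPos π),
    not_isInversion_minPos, isInversion_succAbove_minPos, isInversion_succAbove, false_and,
    and_false, if_false, Finset.sum_const_zero, zero_add, add_zero, Finset.sum_add_distrib]
  congr 1
  refine Finset.sum_congr rfl fun a _ => Finset.sum_congr rfl fun b _ => ?_
  grind

theorem card_I2_eq_add (π : Equiv.Perm (Fin (n + 1))) :
    (I2 π).card = (∑ a, ∑ b, if IsInversion (deleteMin π) a b then
      ∑ i : Fin n, (if i.1 < (minPos π).1 ∧ i ≠ a ∧ i ≠ b then 1 else 0) else 0) +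
        (I2 (deleteMin π)).card := by
  have hne (i : Fin n) : (minPos π).succAbove i ≠ minPos π := Fin.succAbove_ne _ i
  have hne' (i : Fin n) : minPos π ≠ (minPos π).succAbove i := Fin.ne_succAbove _ i
  simp only [card_I2_eq_sum, Fin.sum_univ_succAbove _ (minPos π), not_isInversion_minPos,
    isInversion_succAbove_minPos, isInversion_succAbove, false_and, and_false, true_and, if_false,
    Finset.sum_const_zero, zero_add, add_zero, Finset.sum_add_distrib, ne_eq, hne, hne',
    not_true_eq_false, not_false_eq_true, and_true, Fin.succAbove_lt_succAbove_iff,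
    Fin.succAbove_right_inj, ← add_assoc]
  congr 1
  have reorder : (∑ i : Fin n, ∑ a, ∑ b, if i.1 < (minPos π).1 ∧ IsInversion (deleteMin π) a b ∧
      (¬ i = a ∧ ¬ i = b) ∧ i < a then 1 else 0) =
      ∑ a, ∑ b, ∑ i : Fin n, if i.1 < (minPos π).1 ∧ IsInversion (deleteMin π) a b ∧
      (¬ i = a ∧ ¬ i = b) ∧ i < a then 1 else 0 :=
    Finset.sum_comm.trans (Finset.sum_congr rfl fun a _ => Finset.sum_comm)
  rw [reorder]
  simp only [← Finset.sum_add_distrib]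
  refine Finset.sum_congr rfl fun a _ => Finset.sum_congr rfl fun b _ => ?_
  split_ifs with h
  · exact Finset.sum_congr rfl fun i _ => by grind
  · simp [h]

theorem sum_lt_ne_add (hk : k ≤ n) {a b : Fin n} (hab : a < b) (h : b.1 < k ∨ k ≤ a.1) :
    (∑ i : Fin n, if i.1 < k ∧ i ≠ a ∧ i ≠ b then 1 else 0) + (if b.1 < k then 1 else 0) =
      if b.1 < k then k - 1 else k := by
  have hset : ({i : Fin n | i.1 < k ∧ i ≠ a ∧ i ≠ b} : Finset (Fin n)) =
      ({i : Fin n | i.1 < k} : Finset (Fin n)) \ {a, b} := by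
    ext i
    simp
  rw [← Finset.card_filter, hset]
  have hcard : ({i : Fin n | i.1 < k} : Finset (Fin n)).card = k := by
    rw [Fin.card_filter_val_lt, min_eq_right hk]
  split_ifs with hb
  · rw [Finset.card_sdiff_of_subset (by grind), hcard, Finset.card_pair hab.ne]
    omega
  · rw [Finset.sdiff_eq_self_of_disjoint (by rw [Finset.disjoint_left]; grind), hcard, add_zero]

theorem invCount_self_eq_add (k : ℕ) (π : Equiv.Perm (Fin n)) : invCount n π =
    invCount k π + ∑ a, ∑ b, if IsInversion π a b ∧ ¬ b.1 < k then 1 else 0 := by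
  simp only [invCount_eq_sum, ← Finset.sum_add_distrib]
  refine Finset.sum_congr rfl fun a _ => Finset.sum_congr rfl fun b _ => ?_
  grind

/-- An inversion `(a, b)` of `deleteMin π` is disjoint from the inversions `(i, minPos π)` of `π`
with `i ≠ a, b`; it forms a `321`-pattern with `minPos π` when it lies to the left. -/
theorem card_I2_add_card_I3 {π : Equiv.Perm (Fin (n + 1))}
    (h : Separated (minPos π) (deleteMin π)) :
    (I2 π).card + (I3 π).card = (minPos π - 1) * invCount (minPos π) (deleteMin π) +
      minPos π * (invCount n (deleteMin π) - invCount (minPos π) (deleteMin π)) +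
      ((I2 (deleteMin π)).card + (I3 (deleteMin π)).card) := by
  suffices hs : (∑ a, ∑ b, if IsInversion (deleteMin π) a b then
      ∑ i : Fin n, (if i.1 < (minPos π).1 ∧ i ≠ a ∧ i ≠ b then 1 else 0) else 0) +
        invCount (minPos π) (deleteMin π) = (minPos π - 1) * invCount (minPos π) (deleteMin π) +
      minPos π * ∑ a, ∑ b, if IsInversion (deleteMin π) a b ∧ ¬ b.1 < minPos π then 1 else 0 by
    rw [invCount_self_eq_add (minPos π), Nat.add_sub_cancel_left, card_I2_eq_add, card_I3_eq_add]
    omega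
  simp only [invCount_eq_sum, Finset.mul_sum, ← Finset.sum_add_distrib]
  refine Finset.sum_congr rfl fun a _ => Finset.sum_congr rfl fun b _ => ?_
  by_cases hab : IsInversion (deleteMin π) a b
  · have hside : b.1 < minPos π ∨ minPos π ≤ a.1 := by
      by_contra! hside
      exact (h a b hside.2 hside.1).not_gt hab.2
    have := sum_lt_ne_add (minPos π).is_le hab.1 hside
    simp only [eq_true hab, true_and, if_true, this]
    split_ifs <;> simp
  · simp [hab]

end Counting

section FirstWord

variable {n k : ℕ} {π : Equiv.Perm (Fin n)} {w : List ℕ}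

theorem IsStrandReduced.crossCount_eq (h : IsStrandReduced π w) (hk : Separated k π) :
    crossCount k w = (k - 1) * invCount k π + k * (invCount n π - invCount k π) := by
  rw [RedWord.crossCount_eq, h.length_eq, (h.forall_ne_and_countP_eq hk).2]

theorem isStrandReduced_firstWord (hπ : Avoids π perm312) :
    IsStrandReduced π (firstWord π) ∧ potential n (firstWord π) = (I2 π).card + (I3 π).card := by
  induction n with
  | zero => exact ⟨rfl, by simp [card_I2_eq_sum, card_I3_eq_sum, potential]⟩
  | succ n ih =>
    obtain ⟨hred, hpot⟩ := ih (avoids_deleteMin hπ)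
    have hu := (hred.forall_ne_and_countP_eq hπ.separated).1
    have hw : firstWord π =
        List.range' 0 (minPos π) ++ ((firstWord (deleteMin π)).map (lift (minPos π)) ++ []) := by
      rw [List.append_nil, firstWord]
    simp only [hw, IsStrandReduced, potential, isRightward_range_append, strandEnd_range_append,
      eraseStrand_range_append, postponeCost_range_append, zero_add,
      isRightward_map_lift_append hu, strandEnd_map_lift_append hu, eraseStrand_map_lift_append hu,
      postponeCost_map_lift_append hu, card_I2_add_card_I3 hπ.separated,
      ← hred.crossCount_eq hπ.separated]
    simpa [IsRightward.nil, postponeCost, hpot] using hred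

theorem IsStrandReduced.edist_firstWord_add_le (h : IsStrandReduced π w)
    (hπ : Avoids π perm312) :
    moveGraph.edist w (firstWord π) + potential n w ≤ ((I2 π).card + (I3 π).card : ℕ) := by
  induction n generalizing w with
  | zero => simp [show w = [] from h, firstWord, potential]
  | succ n ih =>
    obtain ⟨hright, hend, herase⟩ := h
    have hav := avoids_deleteMin hπ
    have hne := (herase.forall_ne_and_countP_eq hπ.separated).1
    have hne' := ((isStrandReduced_firstWord hav).1.forall_ne_and_countP_eq hπ.separated).1
    have hcost := postponeCost_add_advanceCost hright (hend ▸ hne)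
    have hadv := edist_advance hright (hend ▸ hne)
    rw [hend, Nat.sub_zero] at hadv
    rw [hend, herase.crossCount_eq hπ.separated] at hcost
    have hfirst := (edist_append_left (List.range' 0 (minPos π)) _ _).trans
      (edist_map_lift hne hne')
    calc moveGraph.edist w (firstWord π) + potential (n + 1) w
        ≤ (advanceCost (minPos π) 0 w +
            moveGraph.edist (eraseStrand 0 w) (firstWord (deleteMin π))) +
          (postponeCost 0 w + potential n (eraseStrand 0 w) : ℕ) := by
          gcongr
          · exact SimpleGraph.edist_triangle.trans (add_le_add hadv hfirst)
          · exact le_rfl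
      _ = (postponeCost 0 w + advanceCost (minPos π) 0 w : ℕ) +
          (moveGraph.edist (eraseStrand 0 w) (firstWord (deleteMin π)) +
            potential n (eraseStrand 0 w)) := by
          push_cast
          ring
      _ ≤ ((I2 π).card + (I3 π).card : ℕ) := by
          rw [hcost, card_I2_add_card_I3 hπ.separated, Nat.cast_add (_ + _)]
          gcongr
          exact ih herase hav

end FirstWord

/-! ### The graph of reduced words -/

section ReducedWords

variable {n : ℕ} {π : Equiv.Perm (Fin n)}

theorem exists_map_val_eq {m : ℕ} {w : List ℕ} (h : ∀ i ∈ w, i < m) :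
    ∃ w' : List (Fin m), w'.map Fin.val = w :=
  ⟨w.pmap Fin.mk h, by simp [List.map_pmap]⟩

theorem map_val_injective (m : ℕ) : Function.Injective (List.map (Fin.val (n := m))) :=
  List.map_injective_iff.2 Fin.val_injective

theorem IsStrandReduced.exists_map_val_eq {w : List ℕ} (h : IsStrandReduced π w) :
    ∃ w' : List (Fin (n - 1)), w'.map Fin.val = w :=
  RedWord.exists_map_val_eq fun i hi => Nat.lt_sub_of_add_lt (h.add_one_lt i hi)

theorem wordProd_eq_iff {w : List (Fin (n - 1))} :
    wordProd w = π ↔ natProd (w.map Fin.val) = extendNat π := by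
  rw [← extendNat_injective.eq_iff, extendNat_wordProd]

theorem isReducedWord_iff {w : List (Fin (n - 1))} :
    IsReducedWord π w ↔ IsStrandReduced π (w.map Fin.val) := by
  constructor
  · rintro ⟨hprod, hmin⟩
    have hlast := (isStrandReduced_lastWord π).1
    obtain ⟨v, hv⟩ := hlast.exists_map_val_eq
    refine isStrandReduced_of_length_le (wordProd_eq_iff.1 hprod) ?_
    rw [← hlast.length_eq, ← hv, List.length_map, List.length_map]
    exact hmin v (wordProd_eq_iff.2 (hv ▸ hlast.natProd_eq))
  · refine fun h => ⟨wordProd_eq_iff.2 h.natProd_eq, fun v hv => ?_⟩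
    rw [← w.length_map Fin.val, h.length_eq, ← v.length_map Fin.val]
    exact invCount_le_length (wordProd_eq_iff.1 hv)

theorem move_map_val_iff {m : ℕ} {w w' : List (Fin m)} :
    Move (w.map Fin.val) (w'.map Fin.val) ↔ CommMove w w' ∨ BraidMove w w' := by
  constructor
  · intro h
    generalize hu : w.map Fin.val = u at h
    generalize hu' : w'.map Fin.val = u' at h
    induction h generalizing w w' with
    | comm h v =>
      match w, hu with
      | j :: k :: v, hu =>
        obtain rfl : w' = k :: j :: v := map_val_injective m (by rw [hu']; simp_all)
        simp only [List.map_cons, List.cons.injEq] at hu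
        exact .inl (.mk [] v j k (by omega))
    | braid h v =>
      match w, hu with
      | j :: k :: l :: v, hu =>
        simp only [List.map_cons, List.cons.injEq] at hu
        obtain rfl : l = j := Fin.ext (by omega)
        obtain rfl : w' = k :: l :: k :: v := map_val_injective m (by rw [hu']; simp_all)
        exact .inr (.mk [] v l k (by omega))
    | cons i _ ih =>
      match w, w', hu, hu' with
      | i :: w, j :: w', hu, hu' =>
        simp only [List.map_cons, List.cons.injEq] at hu hu'
        obtain rfl : i = j := Fin.ext (by omega)
        rcases ih hu.2 hu'.2 with ⟨u, v, j, k, h⟩ | ⟨u, v, j, k, h⟩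
        · exact .inl (.mk (i :: u) v j k h)
        · exact .inr (.mk (i :: u) v j k h)
  · rintro (⟨u, v, j, k, h⟩ | ⟨u, v, j, k, h⟩) <;>
      simp only [List.map_append, List.append_assoc]
    · exact (Move.comm h (v.map Fin.val)).append_left _
    · exact (Move.braid h (v.map Fin.val)).append_left _

theorem edist_G_le (w w' : R π) :
    (G π).edist w w' ≤ moveGraph.edist (w.1.map Fin.val) (w'.1.map Fin.val) := by
  refine edist_le_of_simulation (fun u (x : R π) => x.1.map Fin.val = u) ?_ ?_ rfl rfl
  · exact fun _ x y hx hy => Subtype.ext (map_val_injective _ (hx.trans hy.symm))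
  · rintro _ b x rfl hmove
    have hb := ((isReducedWord_iff.1 x.2).move hmove).1
    obtain ⟨y, rfl⟩ := hb.exists_map_val_eq
    exact ⟨⟨y, isReducedWord_iff.2 hb⟩, rfl, move_map_val_iff.1 hmove⟩

theorem ediam_G (hπ : Avoids π perm312) : (G π).ediam = ((I2 π).card + (I3 π).card : ℕ) := by
  obtain ⟨hlast, hlast_pot⟩ := isStrandReduced_lastWord π
  obtain ⟨hfirst, hfirst_pot⟩ := isStrandReduced_firstWord hπ
  obtain ⟨a, ha⟩ := hlast.exists_map_val_eq
  obtain ⟨b, hb⟩ := hfirst.exists_map_val_eq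
  have dist_last (u : R π) := (isReducedWord_iff.1 u.2).edist_lastWord_le
  have dist_first (u : R π) := (isReducedWord_iff.1 u.2).edist_firstWord_add_le hπ
  rw [← ha] at hlast hlast_pot dist_last
  rw [← hb] at hfirst hfirst_pot dist_first
  exact ediam_eq_of_potential (f := fun w : R π => potential n (w.1.map Fin.val))
    (a := ⟨a, isReducedWord_iff.2 hlast⟩) (b := ⟨b, isReducedWord_iff.2 hfirst⟩)
    (fun u v huv => ((isReducedWord_iff.1 u.2).move (move_map_val_iff.2 huv)).2)
    hlast_pot hfirst_pot (fun u => (edist_G_le _ _).trans (dist_last u))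
    fun u => (add_le_add_left (edist_G_le _ _) _).trans (dist_first u)

end ReducedWords

/-! ### Codimension-two flats of the braid arrangement -/

section Arrangement

variable {n : ℕ} {π : Equiv.Perm (Fin n)}

theorem mem_hyper {i j : Fin n} {x : Fin n → ℝ} : x ∈ hyper i j ↔ x i = x j := Iff.rfl

theorem hyper_comm (i j : Fin n) : hyper i j = hyper j i :=
  Submodule.ext fun _ => eq_comm

theorem hyper_mem_arrangement {i j : Fin n} (h : i ≠ j) : hyper i j ∈ arrangement n := by
  rcases lt_or_gt_of_ne h with h | h
  · exact ⟨i, j, h, rfl⟩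
  · exact ⟨j, i, h, hyper_comm i j⟩

theorem exists_hyper_apply (π : Equiv.Perm (Fin n)) {H : Submodule ℝ (Fin n → ℝ)}
    (hH : H ∈ arrangement n) : ∃ i j : Fin n, i < j ∧ H = hyper (π i) (π j) := by
  obtain ⟨a, b, hab, rfl⟩ := hH
  rcases lt_or_gt_of_ne (π.symm.injective.ne hab.ne) with h | h
  · exact ⟨_, _, h, by simp⟩
  · exact ⟨_, _, h, by simp [hyper_comm]⟩

theorem smul_val_mem_baseChamber {c : ℝ} (hc : 0 < c) :
    (fun i : Fin n => c * i.val) ∈ baseChamber n :=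
  fun _ _ hij => mul_lt_mul_of_pos_left (Nat.cast_lt.2 hij) hc

theorem separates_hyper_iff {a b : Fin n} (hab : a < b) :
    Separates (hyper a b) (baseChamber n) (permChamber π) ↔ π.symm b < π.symm a := by
  constructor
  · rintro ⟨f, hker, hpos, hneg⟩
    by_contra! hle
    have hlt : π.symm a < π.symm b := hle.lt_of_ne (π.symm.injective.ne hab.ne)
    -- Two points, one in each chamber, whose difference lies on the hyperplane.
    let x (t : Fin n) : ℝ := ((π.symm b).val - (π.symm a).val : ℝ) * t.val
    let y (t : Fin n) : ℝ := (b.val - a.val : ℝ) * (π.symm t).val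
    have hx : 0 < f x := hpos x (smul_val_mem_baseChamber (sub_pos.2 (Nat.cast_lt.2 hlt)))
    have hy : f y < 0 :=
      hneg y ⟨_, smul_val_mem_baseChamber (sub_pos.2 (Nat.cast_lt.2 hab)), rfl⟩
    have hxy : x - y ∈ LinearMap.ker f := by
      rw [hker, mem_hyper]
      simp only [Pi.sub_apply, x, y]
      ring
    rw [LinearMap.mem_ker, map_sub] at hxy
    linarith
  · intro h
    refine ⟨LinearMap.proj (R := ℝ) (φ := fun _ => ℝ) b - LinearMap.proj a, ?_, fun x hx => ?_, ?_⟩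
    · ext x
      simp [mem_hyper, sub_eq_zero, eq_comm]
    · simpa using hx hab
    · rintro _ ⟨x, hx, rfl⟩
      simpa using hx h

theorem hyper_mem_L1_iff {i j : Fin n} (hij : i < j) :
    hyper (π i) (π j) ∈ L1 π ↔ IsInversion π i j := by
  have hne : π i ≠ π j := π.injective.ne hij.ne
  rw [L1, Set.mem_ofPred_eq, and_iff_right (hyper_mem_arrangement hne), IsInversion,
    and_iff_right hij]
  rcases lt_or_gt_of_ne hne with h | h
  · simp [separates_hyper_iff h, hij.not_gt, h.not_gt]
  · simp [hyper_comm (π i), separates_hyper_iff h, hij, h]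

theorem inf_hyper_le_iff {a b c d p q : Fin n} (hac : a ≠ c) (had : a ≠ d) (hbc : b ≠ c)
    (hbd : b ≠ d) : hyper a b ⊓ hyper c d ≤ hyper p q ↔
      p = q ∨ ((p = a ∨ p = b) ∧ (q = a ∨ q = b)) ∨ ((p = c ∨ p = d) ∧ (q = c ∨ q = d)) := by
  constructor
  · intro h
    -- A point of the flat whose coordinates agree only where the flat forces them to.
    let x (t : Fin n) : ℕ := if t = a ∨ t = b then 0 else if t = c ∨ t = d then 1 else t.val + 2
    have hx : (fun t => (x t : ℝ)) ∈ hyper a b ⊓ hyper c d := by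
      simp [mem_hyper, x, hac.symm, had.symm, hbc.symm, hbd.symm]
    have hpq : x p = x q := Nat.cast_injective (h hx)
    grind
  · intro h x hx
    rw [Submodule.mem_inf, mem_hyper, mem_hyper] at hx
    rw [mem_hyper]
    grind

theorem inf_hyper_common_le_iff {a b c p q : Fin n} : hyper a b ⊓ hyper b c ≤ hyper p q ↔
    p = q ∨ ((p = a ∨ p = b ∨ p = c) ∧ (q = a ∨ q = b ∨ q = c)) := by
  constructor
  · intro h
    let x (t : Fin n) : ℕ := if t = a ∨ t = b ∨ t = c then 0 else t.val + 1
    have hx : (fun t => (x t : ℝ)) ∈ hyper a b ⊓ hyper b c := by simp [mem_hyper, x]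
    have hpq : x p = x q := Nat.cast_injective (h hx)
    grind
  · intro h x hx
    rw [Submodule.mem_inf, mem_hyper, mem_hyper] at hx
    rw [mem_hyper]
    grind

theorem eq_or_eq_of_hyper_eq {a b p q : Fin n} (hpq : p ≠ q) (h : hyper a b = hyper p q) :
    (p = a ∧ q = b) ∨ (p = b ∧ q = a) := by
  have hle : hyper a b ⊓ hyper b b ≤ hyper p q := h ▸ inf_le_left
  rw [inf_hyper_common_le_iff] at hle
  grind

/-- The intersection `H_{π i, π j} ∩ H_{π k, π l}` for a pair of index pairs `(i, j)`, `(k, l)`;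
these are the flats in `L₂(π)` that come from `I₂(π)`. -/
def pairFlat (π : Equiv.Perm (Fin n)) (p : (Fin n × Fin n) × (Fin n × Fin n)) :
    Submodule ℝ (Fin n → ℝ) :=
  hyper (π p.1.1) (π p.1.2) ⊓ hyper (π p.2.1) (π p.2.2)

/-- The flat on which the coordinates `π i`, `π j`, `π k` agree, for a triple `(i, j, k)`; these
are the flats in `L₂(π)` that come from `I₃(π)`. -/
def tripleFlat (π : Equiv.Perm (Fin n)) (t : Fin n × Fin n × Fin n) :
    Submodule ℝ (Fin n → ℝ) :=
  hyper (π t.1) (π t.2.1) ⊓ hyper (π t.2.1) (π t.2.2)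

theorem mem_I2 {i j k l : Fin n} : ((i, j), (k, l)) ∈ I2 π ↔
    IsInversion π i j ∧ IsInversion π k l ∧ (i ≠ k ∧ i ≠ l ∧ j ≠ k ∧ j ≠ l) ∧ i < k := by
  simp only [I2, Finset.mem_filter_univ, Finset.disjoint_insert_left,
    Finset.disjoint_singleton_left, Finset.mem_insert, Finset.mem_singleton, not_or, ne_eq,
    and_assoc]

theorem mem_I3 {i j k : Fin n} : (i, j, k) ∈ I3 π ↔
    IsInversion π i j ∧ IsInversion π i k ∧ IsInversion π j k := by
  simp only [I3, Finset.mem_filter_univ]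

theorem pairFlat_le_iff {i j k l a b : Fin n} (h : ((i, j), (k, l)) ∈ I2 π) :
    pairFlat π ((i, j), (k, l)) ≤ hyper (π a) (π b) ↔
      a = b ∨ ((a = i ∨ a = j) ∧ (b = i ∨ b = j)) ∨ ((a = k ∨ a = l) ∧ (b = k ∨ b = l)) := by
  obtain ⟨-, -, ⟨hik, hil, hjk, hjl⟩, -⟩ := mem_I2.1 h
  rw [pairFlat, inf_hyper_le_iff (π.injective.ne hik) (π.injective.ne hil) (π.injective.ne hjk)
    (π.injective.ne hjl)]
  simp only [EmbeddingLike.apply_eq_iff_eq]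

theorem tripleFlat_le_iff {i j k a b : Fin n} : tripleFlat π (i, j, k) ≤ hyper (π a) (π b) ↔
    a = b ∨ ((a = i ∨ a = j ∨ a = k) ∧ (b = i ∨ b = j ∨ b = k)) := by
  rw [tripleFlat, inf_hyper_common_le_iff]
  simp only [EmbeddingLike.apply_eq_iff_eq]

theorem inf_hyper_apply_mem_L2_iff {i j k l : Fin n} (hij : i < j) (hkl : k < l)
    (hne : (i, j) ≠ (k, l)) : hyper (π i) (π j) ⊓ hyper (π k) (π l) ∈ L2 π ↔
      ∀ a b, a < b → hyper (π i) (π j) ⊓ hyper (π k) (π l) ≤ hyper (π a) (π b) →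
        IsInversion π a b := by
  have hπkl : π k ≠ π l := π.injective.ne hkl.ne
  have hhyper_ne : hyper (π i) (π j) ≠ hyper (π k) (π l) := by
    intro h
    have := eq_or_eq_of_hyper_eq hπkl h
    simp only [EmbeddingLike.apply_eq_iff_eq] at this
    grind
  refine (and_iff_right ⟨_, hyper_mem_arrangement (π.injective.ne hij.ne), _,
    hyper_mem_arrangement hπkl, hhyper_ne, rfl⟩).trans ⟨fun h a b hab hle => ?_, ?_⟩
  · exact (hyper_mem_L1_iff hab).1 (h _ (hyper_mem_arrangement (π.injective.ne hab.ne)) hle)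
  · intro h H hH hle
    obtain ⟨a, b, hab, rfl⟩ := exists_hyper_apply π hH
    exact (hyper_mem_L1_iff hab).2 (h a b hab hle)

theorem pairFlat_mem_L2 {p : (Fin n × Fin n) × (Fin n × Fin n)} (hp : p ∈ I2 π) :
    pairFlat π p ∈ L2 π := by
  obtain ⟨⟨i, j⟩, k, l⟩ := p
  obtain ⟨hij, hkl, hdisj, -⟩ := mem_I2.1 hp
  refine (inf_hyper_apply_mem_L2_iff hij.1 hkl.1 (by grind)).2 fun a b hab hle => ?_
  have := (pairFlat_le_iff hp).1 hle
  grind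

theorem tripleFlat_mem_L2_iff {i j k : Fin n} (hij : i < j) (hjk : j < k) :
    tripleFlat π (i, j, k) ∈ L2 π ↔ (i, j, k) ∈ I3 π := by
  refine (inf_hyper_apply_mem_L2_iff hij hjk (by grind)).trans ?_
  change (∀ a b, a < b → tripleFlat π (i, j, k) ≤ _ → _) ↔ _
  simp only [tripleFlat_le_iff, mem_I3]
  constructor
  · exact fun h => ⟨h i j hij (by simp), h i k (hij.trans hjk) (by simp), h j k hjk (by simp)⟩
  · grind

theorem exists_tripleFlat_eq {i j k l : Fin n} (hij : i < j) (hkl : k < l)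
    (hne : (i, j) ≠ (k, l)) (hmeet : i = k ∨ i = l ∨ j = k ∨ j = l) :
    ∃ a b c, a < b ∧ b < c ∧
      tripleFlat π (a, b, c) = hyper (π i) (π j) ⊓ hyper (π k) (π l) := by
  simp only [Submodule.ext_iff, tripleFlat, Submodule.mem_inf, mem_hyper]
  rcases hmeet with rfl | rfl | rfl | rfl
  · rcases lt_or_gt_of_ne fun hjl : j = l => hne (hjl ▸ rfl) with h | h
    · exact ⟨i, j, l, hij, h, by grind⟩
    · exact ⟨i, l, j, hkl, h, by grind⟩
  · exact ⟨k, i, j, hkl, hij, by grind⟩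
  · exact ⟨i, j, l, hij, hkl, by grind⟩
  · rcases lt_or_gt_of_ne fun hik : i = k => hne (hik ▸ rfl) with h | h
    · exact ⟨i, k, j, h, hkl, by grind⟩
    · exact ⟨k, i, j, h, hij, by grind⟩

theorem L2_subset (π : Equiv.Perm (Fin n)) :
    L2 π ⊆ pairFlat π '' (I2 π) ∪ tripleFlat π '' (I3 π) := by
  intro X hX
  obtain ⟨⟨H, hH, K, hK, hne, rfl⟩, hL1⟩ := id hX
  obtain ⟨i, j, hij, rfl⟩ := exists_hyper_apply π hH
  obtain ⟨k, l, hkl, rfl⟩ := exists_hyper_apply π hK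
  by_cases hmeet : i = k ∨ i = l ∨ j = k ∨ j = l
  · obtain ⟨a, b, c, hab, hbc, h⟩ := exists_tripleFlat_eq (π := π) hij hkl (by grind) hmeet
    exact .inr ⟨_, (tripleFlat_mem_L2_iff hab hbc).1 (h ▸ hX), h⟩
  · have hinv_ij := (hyper_mem_L1_iff hij).1 (hL1 _ hH inf_le_left)
    have hinv_kl := (hyper_mem_L1_iff hkl).1 (hL1 _ hK inf_le_right)
    simp only [not_or] at hmeet
    rcases lt_or_gt_of_ne hmeet.1 with h | h
    · exact .inl ⟨((i, j), (k, l)), mem_I2.2 ⟨hinv_ij, hinv_kl, hmeet, h⟩, rfl⟩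
    · exact .inl ⟨((k, l), (i, j)), mem_I2.2 ⟨hinv_kl, hinv_ij, by grind, h⟩, inf_comm ..⟩

theorem L2_eq_union (π : Equiv.Perm (Fin n)) :
    L2 π = pairFlat π '' (I2 π) ∪ tripleFlat π '' (I3 π) := by
  refine (L2_subset π).antisymm (Set.union_subset ?_ ?_)
  · rintro _ ⟨p, hp, rfl⟩
    exact pairFlat_mem_L2 hp
  · rintro _ ⟨⟨i, j, k⟩, ht, rfl⟩
    obtain ⟨hij, -, hjk⟩ := mem_I3.1 ht
    exact (tripleFlat_mem_L2_iff hij.1 hjk.1).2 ht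

theorem pairFlat_injOn (π : Equiv.Perm (Fin n)) : Set.InjOn (pairFlat π) (I2 π) := by
  rintro ⟨⟨i, j⟩, k, l⟩ hp ⟨⟨i', j'⟩, k', l'⟩ hp' he
  have hle (a b : Fin n) : _ ↔ _ := (pairFlat_le_iff (a := a) (b := b) hp).symm.trans
    (he ▸ pairFlat_le_iff hp')
  have := mem_I2.1 hp
  have := mem_I2.1 hp'
  have := hle i j
  have := hle k l
  grind

theorem tripleFlat_injOn (π : Equiv.Perm (Fin n)) : Set.InjOn (tripleFlat π) (I3 π) := by
  rintro ⟨i, j, k⟩ ht ⟨i', j', k'⟩ ht' he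
  have hle (a b : Fin n) : _ ↔ _ := (tripleFlat_le_iff (π := π) (a := a) (b := b)).symm.trans
    (he ▸ tripleFlat_le_iff)
  have := mem_I3.1 ht
  have := mem_I3.1 ht'
  have := hle i j
  have := hle j k
  grind

theorem disjoint_pairFlat_tripleFlat (π : Equiv.Perm (Fin n)) :
    Disjoint (pairFlat π '' (I2 π)) (tripleFlat π '' (I3 π)) := by
  rw [Set.disjoint_left]
  rintro _ ⟨⟨⟨i, j⟩, k, l⟩, hp, rfl⟩ ⟨⟨i', j', k'⟩, -, he⟩
  have hle (a b : Fin n) : _ ↔ _ := (pairFlat_le_iff (a := a) (b := b) hp).symm.trans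
    (he ▸ tripleFlat_le_iff)
  have := mem_I2.1 hp
  have := hle i j
  have := hle k l
  have := hle i k
  grind

theorem encard_L2 (π : Equiv.Perm (Fin n)) :
    (L2 π).encard = ((I2 π).card + (I3 π).card : ℕ) := by
  rw [L2_eq_union, Set.encard_union_eq (disjoint_pairFlat_tripleFlat π),
    (pairFlat_injOn π).encard_image, (tripleFlat_injOn π).encard_image,
    Set.encard_coe_eq_coe_finsetCard, Set.encard_coe_eq_coe_finsetCard, Nat.cast_add]

end Arrangement

end RedWord

theorem theorem6p5 (n : ℕ) (π : Equiv.Perm (Fin n)) (hπ : RedWord.Avoids π RedWord.perm312) :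
    (RedWord.G π).ediam = (RedWord.L2 π).encard ∧
      (RedWord.L2 π).encard = (((RedWord.I2 π).card + (RedWord.I3 π).card : ℕ) : ℕ∞) :=
  ⟨(RedWord.ediam_G hπ).trans (RedWord.encard_L2 π).symm, RedWord.encard_L2 π⟩
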